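/- Let $S^1\subset\mathbb C$ be the unit circle and let $G=\mathbb R/\mathbb Z\rtimes\{1,-1\}$, with elements written $e^tv$, act on $S^1$ by $e^t1(x)=x\,e^{2\pi i t}$ and $e^t(-1)(x)=\overline{x}\,e^{2\pi i t}$, and on the torus $T=S^1\times S^1$ by $e^tv(x,y)=(vx,\,e^tv(y))$, where $vx=e^0v(x)$. Let $K=\{e^{2\pi i t}:0\le t<\tfrac12\}$, $D=S^1\setminus K$, $X[\epsilon]=S^1\times K$ (the consonant intervals), $D[\epsilon]=S^1\times D$, and $q=e^{1/2}1$, which acts by $(x,y)\mapsto(x,-y)$. For $\xi\in X[\epsilon]$ call $g\in G$ *admissible for $\xi$* if $\xi\in g(D[\epsilon])$ and $g$ commutes with $q$ as a map of $T$. Let $\tau_q$ be the topology on $T$ given by the Kuratowski closure operator $A\mapsto \overline{A}\cup q(\overline{A})$, where $\overline{A}$ is the closure in the standard topology. 1. After identification of topologically indistinguishable points (that is, of $z$ with $q(z)$), $(T,\tau_q)$ is homeomorphic to $T$ with its standard topology; under the same identification each section $\{x\}\times S^1$, as a subspace of $(T,\tau_q)$, is homeomorphic to the real projective line $\mathbb{RP}^1$;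 and $\mathbb{RP}^1$ is homeomorphic to $S^1$. 2. For $g\in G$: $g(X[\epsilon])=D[\epsilon]$ if and only if $g=q$, and $g(X[\epsilon])\cap X[\epsilon]=\emptyset$ if and only if $g=q$. 3. Let $T$ carry either the standard topology or $\tau_q$, and let $\xi=(x,k)\in X[\epsilon]$. - For every $g\ne q$ admissible for $\xi$, the subspace $g(X[\epsilon])\cap X[\epsilon]$ is homotopy equivalent to $S^1$, and its first singular homology group satisfies $H_1(g(X[\epsilon])\cap X[\epsilon];\mathbb Z)\cong\mathbb Z$. - Call $g$ a *homological counterpoint symmetry of $\xi$* if $g$ is admissible for $\xi$ and the rank of $H_1(g(X[\epsilon])\cap X[\epsilon];\mathbb Z)$ is maximal among all elements admissible for $\xi$. These symmetries are exactly the $g\neq q$ admissible for $\xi$. - Call the members of $g(X[\epsilon])\cap X[\epsilon]$, for $g$ a homological counterpoint symmetry of $\xi$, the *admitted successors* of $\xi$. The set of all admitted successors of $\xi$ is $S^1\times(K\setminus\{k\})$: every consonant interval is admitted, over every cantus firmus, except the given discantus interval $k$ itself. -/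

import Mathlib

open scoped ContinuousMap

noncomputable section

namespace ContinuousCounterpoint

/-! ### The group `G = ℝ/ℤ ⋊ ℤ₂` and its actions -/

/-- The action of `ℤ₂ = {1, -1}` on `ℝ/ℤ` by `t ↦ v t`. -/
def signAut : ℤˣ →* MulAut (Multiplicative UnitAddCircle) where
  toFun v :=
    { toFun := fun t => t ^ (v : ℤ)
      invFun := fun t => t ^ (v : ℤ)
      left_inv := fun t => by
        rcases Int.units_eq_one_or v with rfl | rfl <;> simp
      right_inv := fun t => by
        rcases Int.units_eq_one_or v with rfl | rfl <;> simp
      map_mul' := fun s t => mul_zpow s t (v : ℤ) }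
  map_one' := by ext t; simp
  map_mul' v w := by
    ext t
    change t ^ ((v * w : ℤˣ) : ℤ) = (t ^ (w : ℤ)) ^ (v : ℤ)
    rw [← zpow_mul, mul_comm, Units.val_mul]

/-- The group `G = ℝ/ℤ ⋊ ℤ₂`. -/
abbrev G : Type := Multiplicative UnitAddCircle ⋊[signAut] ℤˣ

/-- The element `e^t v` of `G`. -/
def affine (t : ℝ) (v : ℤˣ) : G := ⟨Multiplicative.ofAdd (t : UnitAddCircle), v⟩

/-- The linear part `v` acting on `S¹`: the identity for `v = 1`, and complex conjugation
(which on `S¹` is inversion) for `v = -1`. -/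
def lin (v : ℤˣ) (x : Circle) : Circle := x ^ (v : ℤ)

/-- The action of `G` on `S¹`: `e^t v (x) = (v x) exp (2 π i t)`. -/
def circleAct (g : G) (x : Circle) : Circle :=
  lin g.right x * AddCircle.toCircle (Multiplicative.toAdd g.left)

/-- The torus `T = S¹ × S¹`; first component the cantus firmus, second the discantus interval. -/
abbrev Torus : Type := Circle × Circle

/-- The underlying map of the action of `G` on `T`: `e^t v (x, y) = (v x, e^t v (y))`. -/
def torusFun (g : G) (z : Torus) : Torus := (lin g.right z.1, circleAct g z.2)

theorem torusFun_one (z : Torus) : torusFun 1 z = z := by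
  simp [torusFun, lin, circleAct]

theorem torusFun_mul (g h : G) (z : Torus) : torusFun (g * h) z = torusFun g (torusFun h z) := by
  have key : AddCircle.toCircle (Multiplicative.toAdd (signAut g.right h.left)) =
      AddCircle.toCircle (Multiplicative.toAdd h.left) ^ ((g.right : ℤˣ) : ℤ) := by
    rw [← AddCircle.toCircle_zsmul]
    rfl
  ext1
  · simp [torusFun, lin, ← zpow_mul, mul_comm]
  · simp only [torusFun, lin, circleAct, SemidirectProduct.mul_left, SemidirectProduct.mul_right,
      toAdd_mul, AddCircle.toCircle_add, key, mul_zpow, Units.val_mul, ← zpow_mul]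
    rw [mul_comm (g.right : ℤ) (h.right : ℤ)]
    simp only [mul_comm, mul_left_comm]

theorem continuous_torusFun (g : G) : Continuous (torusFun g) := by
  unfold torusFun circleAct lin
  fun_prop

/-- The action of `G` on `T` by homeomorphisms. -/
def torusAct : G →* (Torus ≃ₜ Torus) where
  toFun g :=
    { toFun := torusFun g
      invFun := torusFun g⁻¹
      left_inv := fun z => by rw [← torusFun_mul, inv_mul_cancel, torusFun_one]
      right_inv := fun z => by rw [← torusFun_mul, mul_inv_cancel, torusFun_one]
      continuous_toFun := continuous_torusFun g
      continuous_invFun := continuous_torusFun g⁻¹ }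
  map_one' := by ext1 z; exact torusFun_one z
  map_mul' g h := by ext1 z; exact torusFun_mul g h z

/-! ### Consonances, dissonances and the quasipolarity -/

/-- The consonances: the image of `[0, 1/2)` under `t ↦ exp (2 π i t)`. -/
def K : Set Circle := (fun t : ℝ => Circle.exp (2 * Real.pi * t)) '' Set.Ico 0 (1 / 2)

/-- The dissonances. -/
def D : Set Circle := Kᶜ

/-- The consonant intervals `X[ε] = S¹ × K`. -/
def Keps : Set Torus := Set.univ ×ˢ K

/-- The dissonant intervals `S¹ × D`. -/
def Deps : Set Torus := Set.univ ×ˢ D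

/-- The element `e^{1/2} 1` of `G`. -/
def quasipolarity : G := affine (1 / 2) 1

/-- `g X[ε] ∩ X[ε]`. -/
def successorSet (g : G) : Set Torus := (torusAct g '' Keps) ∩ Keps

/-- The first two conditions on a counterpoint symmetry of `ξ`: `ξ ∈ g (D[ε])`, and `g` commutes
with the quasipolarity. -/
structure Admissible (ξ : Torus) (g : G) : Prop where
  mem : ξ ∈ torusAct g '' Deps
  comm : Commute (torusAct g) (torusAct quasipolarity)

/-! ### Kuratowski closure operators -/

/-- A Kuratowski closure operator on a set. -/
structure KuratowskiClosure (X : Type) where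
  cl : Set X → Set X
  cl_empty : cl ∅ = ∅
  subset_cl : ∀ A, A ⊆ cl A
  cl_union : ∀ A B, cl (A ∪ B) = cl A ∪ cl B
  cl_cl : ∀ A, cl (cl A) = cl A

namespace KuratowskiClosure

variable {X : Type}

theorem cl_mono (c : KuratowskiClosure X) {A B : Set X} (h : A ⊆ B) : c.cl A ⊆ c.cl B := by
  rw [← Set.union_eq_self_of_subset_left h, c.cl_union]
  exact Set.subset_union_left

/-- The topology of a Kuratowski closure operator: the closed sets are the fixed points. -/
@[reducible] def topology (c : KuratowskiClosure X) : TopologicalSpace X :=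
  TopologicalSpace.ofClosed {A | c.cl A = A} c.cl_empty
    (fun 𝒜 h𝒜 => Set.Subset.antisymm
      (Set.subset_sInter fun A hA => (c.cl_mono (Set.sInter_subset_of_mem hA)).trans (h𝒜 hA).le)
      (c.subset_cl _))
    (fun A hA B hB => by
      have hA : c.cl A = A := hA
      have hB : c.cl B = B := hB
      change c.cl (A ∪ B) = A ∪ B
      rw [c.cl_union, hA, hB])

/-- The Kuratowski closure operator `A ↦ cl A ∪ p (cl A)` induced by an involutive
homeomorphism `p` of a topological space. -/
def ofInvolution [TopologicalSpace X] (p : X ≃ₜ X) (hp : Function.Involutive p) :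
    KuratowskiClosure X where
  cl A := closure A ∪ p '' closure A
  cl_empty := by simp
  subset_cl A := subset_closure.trans Set.subset_union_left
  cl_union A B := by
    rw [closure_union, Set.image_union, Set.union_union_union_comm]
  cl_cl A := by
    have h1 : closure (closure A ∪ p '' closure A) = closure A ∪ p '' closure A :=
      (isClosed_closure.union (p.isClosedMap _ isClosed_closure)).closure_eq
    have h2 : p '' (p '' closure A) = closure A := by
      rw [Set.image_image]
      simp [hp _]
    rw [h1, Set.image_union, h2, Set.union_comm (p '' closure A), Set.union_self]

end KuratowskiClosure

theorem quasipolarity_mul_self : quasipolarity * quasipolarity = 1 := by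
  ext1
  · change Multiplicative.ofAdd (((1 / 2 : ℝ) : UnitAddCircle)) *
      signAut 1 (Multiplicative.ofAdd (((1 / 2 : ℝ) : UnitAddCircle))) = 1
    rw [map_one, MulAut.one_apply, ← ofAdd_add, ← AddCircle.coe_add]
    norm_num
  · rfl

theorem quasipolarity_involutive : Function.Involutive (torusAct quasipolarity) := fun z => by
  change torusFun quasipolarity (torusFun quasipolarity z) = z
  rw [← torusFun_mul, quasipolarity_mul_self, torusFun_one]

/-- The standard topology of the torus. -/
@[reducible] def standardTopology : TopologicalSpace Torus := inferInstance

/-- The topology on the torus of the Kuratowski closure operator induced by `e^{1/2} 1`. -/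
@[reducible] def kuratowskiTopology : TopologicalSpace Torus :=
  (KuratowskiClosure.ofInvolution (torusAct quasipolarity) quasipolarity_involutive).topology

/-- The set `T` endowed with the topology `τ`. -/
def TorusWith (_ : TopologicalSpace Torus) : Type := Torus

instance (τ : TopologicalSpace Torus) : TopologicalSpace (TorusWith τ) := τ

/-- A point of `T` endowed with `τ`, as a point of `T`. -/
def TorusWith.point {τ : TopologicalSpace Torus} (z : TorusWith τ) : Torus := z

/-- A subset `A` of `T`, as a subspace of `T` endowed with `τ`. -/
abbrev SubspaceOf (τ : TopologicalSpace Torus) (A : Set Torus) : Type :=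
  {z : TorusWith τ // z.point ∈ A}

/-- The section `{x} × S¹` of the torus. -/
def fibre (x : Circle) : Set Torus := {x} ×ˢ Set.univ

/-- The real projective line: lines in `ℝ²`, with the quotient topology from `ℝ² \ {0}`. -/
def RP1 : Type := Projectivization ℝ (Fin 2 → ℝ)

instance : TopologicalSpace RP1 :=
  TopologicalSpace.coinduced (Projectivization.mk' ℝ : {v : Fin 2 → ℝ // v ≠ 0} → _) inferInstance

/-! ### Homology and counterpoint symmetries -/

/-- First singular homology with integer coefficients. -/
def H1 (Y : Type) [TopologicalSpace Y] : ModuleCat.{0} ℤ :=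
  ((AlgebraicTopology.singularHomologyFunctor (ModuleCat.{0} ℤ) 1).obj (ModuleCat.of ℤ ℤ)).obj
    (TopCat.of Y)

/-- Counterpoint symmetries of `ξ` in the homological sense: maximization of cardinality is
replaced by maximization of the rank of `H₁ (g X[ε] ∩ X[ε])`. -/
structure IsHomologicalSymmetry (τ : TopologicalSpace Torus) (ξ : Torus) (g : G) : Prop where
  admissible : Admissible ξ g
  maximal : ∀ h : G, Admissible ξ h →
    Module.rank ℤ (H1 (SubspaceOf τ (successorSet h))) ≤
      Module.rank ℤ (H1 (SubspaceOf τ (successorSet g)))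

/-- The admitted successors of `ξ`: the members of `g X[ε] ∩ X[ε]`, where `g` runs through the
counterpoint symmetries of `ξ` in the homological sense. -/
def admittedSuccessors (τ : TopologicalSpace Torus) (ξ : Torus) : Set Torus :=
  {z | ∃ g : G, IsHomologicalSymmetry τ ξ g ∧ z ∈ successorSet g}

end ContinuousCounterpoint

end

/-!
The covering `exp : ℝ → S¹` presents the singular chains of `S¹` as the coinvariants of those of
`ℝ` under the translation `T` by a period: simplices lift, and the powers of `T` permute the lifts
of a simplex simply transitively. Hence `0 → C(ℝ) → C(ℝ) → C(S¹) → 0`, with `T - 1` as first map,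
is exact. Since `ℝ` is contractible and `T` is homotopic to the identity, the long exact sequence
identifies `H₁(S¹)` with `H₀(ℝ)`, the module of coefficients.

The set `g(X[ε]) ∩ X[ε]` is `S¹ × (gK ∩ K)`. Here `gK` and `K` are half circles, closed at only one
end, so `gK ∩ K` is always connected, and it is empty only if `gK` is the complement of `K`, that
is, if `g = q`. Every `g` commutes with `q`, so `g` is admissible for `(x, k)` precisely if
`k ∉ gK`. Then `gK ∩ K` is a connected proper subset of the circle, hence contractible when
nonempty, and the product is homotopy equivalent to `S¹`.

The topology `τ_q` is induced by `(x, y) ↦ (x, y²)`, whose fibres are the orbits of `q`. This map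
is injective on `X[ε]`, so the previous argument applies to the image of the arc under squaring.
-/

namespace ContinuousCounterpoint

section Coinvariants

open Finsupp

variable {E : Type*} {f : E → E}

theorem periodicPts_nonempty_of_mapsTo {s : Set E} (hs : s.Finite) (hne : s.Nonempty)
    (hf : Set.MapsTo f s s) : (Function.periodicPts f).Nonempty := by
  obtain ⟨a, ha⟩ := hne
  obtain ⟨m, n, hmn, h⟩ := hs.exists_lt_map_eq_of_forall_mem fun n : ℕ => hf.iterate n ha
  refine ⟨f^[m] a, Function.mk_mem_periodicPts (Nat.sub_pos_of_lt hmn) ?_⟩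
  rw [Function.IsPeriodicPt, Function.IsFixedPt, ← Function.iterate_add_apply,
    Nat.sub_add_cancel hmn.le, h]

theorem mapsTo_support_of_mapDomain_eq_self {M : Type*} [AddCommMonoid M] {x : E →₀ M}
    (hx : x.mapDomain f = x) :
    Set.MapsTo f x.support x.support := by
  classical
  have hsub : x.support ⊆ x.support.image f := by
    conv_lhs => rw [← hx]
    exact mapDomain_support
  have himage : x.support = x.support.image f :=
    Finset.eq_of_subset_of_card_le hsub Finset.card_image_le
  intro a ha
  rw [himage]
  exact Finset.mem_image_of_mem f ha

variable (R M : Type*) [Ring R] [AddCommGroup M] [Module R M]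

theorem lmapDomain_sub_id_injective (hf : Function.periodicPts f = ∅) :
    Function.Injective (lmapDomain M R f - LinearMap.id : (E →₀ M) →ₗ[R] (E →₀ M)) := by
  rw [injective_iff_map_eq_zero]
  intro x hx
  by_contra hne
  exact (periodicPts_nonempty_of_mapsTo x.support.finite_toSet (support_nonempty_iff.2 hne)
    (mapsTo_support_of_mapDomain_eq_self (sub_eq_zero.1 hx))).ne_empty hf

theorem exact_lmapDomain_sub_id {B : Type*} {p : E → B} (hp : Function.Surjective p)
    (hpf : p ∘ f = p) (hfib : ∀ a b, p a = p b → ∃ m n : ℕ, f^[m] a = f^[n] b) :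
    Function.Exact (lmapDomain M R f - LinearMap.id : (E →₀ M) →ₗ[R] (E →₀ M))
      (lmapDomain M R p) := by
  set S := LinearMap.range (lmapDomain M R f - LinearMap.id : (E →₀ M) →ₗ[R] (E →₀ M))
  have iterate_mem (n : ℕ) (a : E) (c : M) : single (f^[n] a) c - single a c ∈ S := by
    induction n generalizing a with
    | zero => simp
    | succ n ih =>
      have hstep : single (f a) c - single a c ∈ S := ⟨single a c, by simp⟩
      simpa using S.add_mem (ih (f a)) hstep
  have fibre_mem {a b : E} (hab : p a = p b) (c : M) : single a c - single b c ∈ S := by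
    obtain ⟨m, n, hmn⟩ := hfib a b hab
    have := S.sub_mem (iterate_mem n b c) (iterate_mem m a c)
    rwa [hmn, sub_sub_sub_cancel_left] at this
  obtain ⟨s, hs⟩ := hp.hasRightInverse
  have section_mem (x : E →₀ M) : x - mapDomain s (mapDomain p x) ∈ S := by
    induction x using Finsupp.induction_linear with
    | zero => simp
    | add x y hx hy =>
      rw [mapDomain_add, mapDomain_add, add_sub_add_comm]
      exact S.add_mem hx hy
    | single a c =>
      rw [mapDomain_single, mapDomain_single]
      exact fibre_mem (hs (p a)).symm c
  refine fun x => ⟨fun hx => ?_, ?_⟩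
  · have hmem := section_mem x
    rwa [show mapDomain p x = 0 from hx, mapDomain_zero, sub_zero] at hmem
  · rintro ⟨y, rfl⟩
    change mapDomain p (mapDomain f y - y) = 0
    rw [mapDomain_sub, ← mapDomain_comp, hpf, sub_self]

end Coinvariants

section SimplicialChains

universe w u

open CategoryTheory Limits Simplicial

variable (R : Type w) [CommRing R] (M : Type u) [AddCommGroup M] [Module R M]

/-- The simplicial `n`-chains of `X` with coefficients in the module `M`, as finitely supported
functions from the `n`-simplices to `M`. The complex of Mathlib has abstract coproducts of copies
of `M` as its terms, and this makes its elements accessible. -/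
noncomputable def chainsIso (X : SSet.{u}) (n : ℕ) :
    (X.chainComplex (ModuleCat.of R M)).X n ≅ ModuleCat.of R (X _⦋n⦌ →₀ M) :=
  (X.isColimitChainComplexXCofan (ModuleCat.of R M) n).coconePointUniqueUpToIso
    (ModuleCat.finsuppCoconeIsColimit R M (X _⦋n⦌))

theorem ιChainComplex_chainsIso_hom {X : SSet.{u}} {n : ℕ} (x : X _⦋n⦌) :
    X.ιChainComplex x ≫ (chainsIso R M X n).hom = ModuleCat.ofHom (Finsupp.lsingle x) :=
  IsColimit.comp_coconePointUniqueUpToIso_hom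
    (X.isColimitChainComplexXCofan (ModuleCat.of R M) n) _ ⟨x⟩

theorem chainsIso_naturality {X Y : SSet.{u}} (f : X ⟶ Y) (n : ℕ) :
    (SSet.chainComplexMap f (ModuleCat.of R M)).f n ≫ (chainsIso R M Y n).hom =
      (chainsIso R M X n).hom ≫
        ModuleCat.ofHom (Finsupp.lmapDomain M R (f.app (.op ⦋n⦌))) := by
  refine SSet.chainComplex_hom_ext fun x => ?_
  rw [SSet.ι_chainComplexMap_f_assoc, ιChainComplex_chainsIso_hom, ← Category.assoc,
    ιChainComplex_chainsIso_hom]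
  ext
  simp [Finsupp.lmapDomain_apply]

theorem shortExact_chainComplexMap_sub_id {X Y : SSet.{u}} {f : X ⟶ X} {p : X ⟶ Y}
    (hpf : f ≫ p = p) (hf : ∀ n, Function.periodicPts (f.app (.op ⦋n⦌)) = ∅)
    (hp : ∀ n, Function.Surjective (p.app (.op ⦋n⦌)))
    (hfib : ∀ n (a b : X _⦋n⦌), p.app (.op ⦋n⦌) a = p.app (.op ⦋n⦌) b →
      ∃ k l : ℕ, (f.app (.op ⦋n⦌))^[k] a = (f.app (.op ⦋n⦌))^[l] b) :
    (ShortComplex.mk (SSet.chainComplexMap f (ModuleCat.of R M) - 𝟙 _)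
      (SSet.chainComplexMap p (ModuleCat.of R M))
      (by rw [Preadditive.sub_comp, ← Functor.map_comp, hpf, Category.id_comp,
        sub_self])).ShortExact := by
  refine HomologicalComplex.shortExact_of_degreewise_shortExact _ fun n => ?_
  have hpfn : p.app (.op ⦋n⦌) ∘ f.app (.op ⦋n⦌) = p.app (.op ⦋n⦌) := by
    conv_rhs => rw [← hpf]
    rfl
  have hexact := exact_lmapDomain_sub_id R M (hp n) hpfn (hfib n)
  let S : ShortComplex (ModuleCat R) := ShortComplex.mk
    (ModuleCat.ofHom (Finsupp.lmapDomain M R (f.app (.op ⦋n⦌)) - LinearMap.id))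
    (ModuleCat.ofHom (Finsupp.lmapDomain M R (p.app (.op ⦋n⦌))))
    (ModuleCat.hom_ext hexact.linearMap_comp_eq_zero)
  have hS : S.ShortExact :=
    { exact := (ShortComplex.ShortExact.moduleCat_exact_iff_function_exact S).2 hexact
      mono_f := (ModuleCat.mono_iff_injective _).2 (lmapDomain_sub_id_injective R M (hf n))
      epi_g := (ModuleCat.epi_iff_surjective _).2 (Finsupp.mapDomain_surjective (hp n)) }
  refine ShortComplex.shortExact_of_iso (ShortComplex.isoMk (chainsIso R M X n)
    (chainsIso R M X n) (chainsIso R M Y n) ?_ ?_).symm hS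
  · change (chainsIso R M X n).hom ≫
      (ModuleCat.ofHom (Finsupp.lmapDomain M R (f.app (.op ⦋n⦌))) - 𝟙 _) =
      ((SSet.chainComplexMap f (ModuleCat.of R M)).f n - 𝟙 _) ≫ (chainsIso R M X n).hom
    rw [Preadditive.comp_sub, Preadditive.sub_comp, chainsIso_naturality, Category.id_comp,
      Category.comp_id]
  · exact (chainsIso_naturality R M p n).symm

end SimplicialChains

section HomotopyInvariance

universe u

open CategoryTheory Limits AlgebraicTopology

variable {X Y : Type u} [TopologicalSpace X] [TopologicalSpace Y]
variable {C : Type*} [Category* C] [Preadditive C] [CategoryWithHomology C] [HasCoproducts.{u} C]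

theorem singularHomology_map_eq_of_homotopic (A : C) (n : ℕ) {f g : C(X, Y)} (h : f.Homotopic g) :
    ((singularHomologyFunctor C n).obj A).map (TopCat.ofHom f) =
      ((singularHomologyFunctor C n).obj A).map (TopCat.ofHom g) :=
  TopCat.Homotopy.congr_homologyMap_singularChainComplexFunctor (f := TopCat.ofHom f)
    (g := TopCat.ofHom g) h.some A n

/-- The isomorphism induced by a homotopy equivalence on singular homology with coefficients in an
object of an arbitrary preadditive category with homology and coproducts. -/
noncomputable def singularHomologyIso (A : C) (n : ℕ) (e : ContinuousMap.HomotopyEquiv X Y) :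
    ((singularHomologyFunctor C n).obj A).obj (TopCat.of X) ≅
      ((singularHomologyFunctor C n).obj A).obj (TopCat.of Y) where
  hom := ((singularHomologyFunctor C n).obj A).map (TopCat.ofHom e.toFun)
  inv := ((singularHomologyFunctor C n).obj A).map (TopCat.ofHom e.invFun)
  hom_inv_id := by
    rw [← Functor.map_comp, ← TopCat.ofHom_comp,
      singularHomology_map_eq_of_homotopic A n e.left_inv, TopCat.ofHom_id,
      CategoryTheory.Functor.map_id]
  inv_hom_id := by
    rw [← Functor.map_comp, ← TopCat.ofHom_comp,
      singularHomology_map_eq_of_homotopic A n e.right_inv, TopCat.ofHom_id,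
      CategoryTheory.Functor.map_id]

theorem isZero_singularHomology_of_contractibleSpace [ContractibleSpace X] (A : C) {n : ℕ}
    (hn : n ≠ 0) : IsZero (((singularHomologyFunctor C n).obj A).obj (TopCat.of X)) := by
  obtain ⟨e⟩ := ContractibleSpace.hequiv X PUnit.{u + 1}
  exact (isZero_singularHomologyFunctor_of_totallyDisconnectedSpace C n A (TopCat.of PUnit)
    hn).of_iso (singularHomologyIso A n e)

end HomotopyInvariance

section InfiniteCyclicCovering

universe w u

open CategoryTheory Limits AlgebraicTopology Simplicial

variable {E B : Type u} [TopologicalSpace E] [TopologicalSpace B]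

theorem toSSetObjEquiv_map {X Y : TopCat.{u}} (f : X ⟶ Y) (n : ℕ)
    (σ : (TopCat.toSSet.obj X) _⦋n⦌) :
    TopCat.toSSetObjEquiv Y (.op ⦋n⦌) ((TopCat.toSSet.map f).app (.op ⦋n⦌) σ) =
      f.hom.comp (TopCat.toSSetObjEquiv X (.op ⦋n⦌) σ) :=
  rfl

instance locallyPathConnectedSpace_stdSimplex (ι : Type*) [Fintype ι] :
    LocallyPathConnectedSpace (stdSimplex ℝ ι) :=
  (convex_stdSimplex ℝ ι).locallyPathConnectedSpace

instance contractibleSpace_stdSimplex (ι : Type*) [Fintype ι] [Nonempty ι] :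
    ContractibleSpace (stdSimplex ℝ ι) := by
  classical
  exact (convex_stdSimplex ℝ ι).contractibleSpace
    ⟨_, (stdSimplex.vertex (Classical.arbitrary ι)).2⟩

theorem toSSet_map_surjective {p : C(E, B)} (hp : IsCoveringMap p)
    (hsurj : Function.Surjective p) (n : ℕ) :
    Function.Surjective ((TopCat.toSSet.map (TopCat.ofHom p)).app (.op ⦋n⦌)) := by
  intro σ
  let s : C(stdSimplex ℝ (Fin (n + 1)), B) := TopCat.toSSetObjEquiv (TopCat.of B) (.op ⦋n⦌) σ
  obtain ⟨e, he⟩ := hsurj (s (stdSimplex.vertex 0))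
  obtain ⟨F, ⟨-, hF⟩, -⟩ := hp.existsUnique_continuousMap_lifts s (stdSimplex.vertex 0) e he
  refine ⟨(TopCat.toSSetObjEquiv (TopCat.of E) (.op ⦋n⦌)).symm F, ?_⟩
  apply (TopCat.toSSetObjEquiv (TopCat.of B) (.op ⦋n⦌)).injective
  rw [toSSetObjEquiv_map, Equiv.apply_symm_apply]
  exact ContinuousMap.coe_injective hF

theorem toSSetObjEquiv_iterate_map (T : C(E, E)) (n k : ℕ)
    (σ : (TopCat.toSSet.obj (TopCat.of E)) _⦋n⦌) (x : stdSimplex ℝ (Fin (n + 1))) :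
    TopCat.toSSetObjEquiv (TopCat.of E) (.op ⦋n⦌)
        (((TopCat.toSSet.map (TopCat.ofHom T)).app (.op ⦋n⦌))^[k] σ) x =
      T^[k] (TopCat.toSSetObjEquiv (TopCat.of E) (.op ⦋n⦌) σ x) := by
  induction k generalizing σ with
  | zero => rfl
  | succ _ ih => exact ih _

theorem periodicPts_toSSet_map {T : C(E, E)} (hT : Function.periodicPts T = ∅) (n : ℕ) :
    Function.periodicPts ((TopCat.toSSet.map (TopCat.ofHom T)).app (.op ⦋n⦌)) = ∅ := by
  refine Set.eq_empty_of_forall_notMem fun σ ⟨k, hk, hσ⟩ => ?_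
  refine (hT ▸ Function.mk_mem_periodicPts hk ?_ :
    TopCat.toSSetObjEquiv (TopCat.of E) (.op ⦋n⦌) σ (stdSimplex.vertex 0) ∈ (∅ : Set E))
  rw [Function.IsPeriodicPt, Function.IsFixedPt, ← toSSetObjEquiv_iterate_map, hσ]

theorem exists_iterate_eq_of_toSSet_map_eq {p : C(E, B)} {T : C(E, E)} (hp : IsCoveringMap p)
    (hpT : p.comp T = p) (hfib : ∀ a b, p a = p b → ∃ k l : ℕ, T^[k] a = T^[l] b) (n : ℕ)
    (σ τ : (TopCat.toSSet.obj (TopCat.of E)) _⦋n⦌)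
    (h : (TopCat.toSSet.map (TopCat.ofHom p)).app (.op ⦋n⦌) σ =
      (TopCat.toSSet.map (TopCat.ofHom p)).app (.op ⦋n⦌) τ) :
    ∃ k l : ℕ, ((TopCat.toSSet.map (TopCat.ofHom T)).app (.op ⦋n⦌))^[k] σ =
      ((TopCat.toSSet.map (TopCat.ofHom T)).app (.op ⦋n⦌))^[l] τ := by
  let simplex := TopCat.toSSetObjEquiv (TopCat.of E) (.op ⦋n⦌)
  have hcomp : p ∘ simplex σ = p ∘ simplex τ := congrArg DFunLike.coe
    (congrArg (TopCat.toSSetObjEquiv (TopCat.of B) (.op ⦋n⦌)) h)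
  have hpT_iterate (k : ℕ) : p ∘ T^[k] = p :=
    Function.iterate_invariant (by rw [← ContinuousMap.coe_comp, hpT]) k
  obtain ⟨k, l, hkl⟩ := hfib _ _ (congrFun hcomp (stdSimplex.vertex 0))
  refine ⟨k, l, simplex.injective (DFunLike.coe_injective ?_)⟩
  refine hp.eq_of_comp_eq (map_continuous _) (map_continuous _) ?_ (stdSimplex.vertex 0) ?_
  · have hcoe (k : ℕ) (ρ) :
        ⇑(simplex (((TopCat.toSSet.map (TopCat.ofHom T)).app (.op ⦋n⦌))^[k] ρ)) =
          T^[k] ∘ simplex ρ := funext (toSSetObjEquiv_iterate_map T n k ρ)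
    rw [hcoe, hcoe, ← Function.comp_assoc, ← Function.comp_assoc, hpT_iterate, hpT_iterate, hcomp]
  · exact (toSSetObjEquiv_iterate_map ..).trans
      (hkl.trans (toSSetObjEquiv_iterate_map ..).symm)

variable (R : Type w) [CommRing R] (M : Type u) [AddCommGroup M] [Module R M]

theorem shortExact_singularChains_of_isCoveringMap {p : C(E, B)} {T : C(E, E)}
    (hp : IsCoveringMap p) (hsurj : Function.Surjective p) (hpT : p.comp T = p)
    (hT : Function.periodicPts T = ∅) (hfib : ∀ a b, p a = p b → ∃ k l : ℕ, T^[k] a = T^[l] b) :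
    (ShortComplex.mk
      (SSet.chainComplexMap (TopCat.toSSet.map (TopCat.ofHom T)) (ModuleCat.of R M) - 𝟙 _)
      (SSet.chainComplexMap (TopCat.toSSet.map (TopCat.ofHom p)) (ModuleCat.of R M)) (by
        rw [Preadditive.sub_comp, ← Functor.map_comp, ← Functor.map_comp, ← TopCat.ofHom_comp,
          hpT, Category.id_comp, sub_self])).ShortExact :=
  shortExact_chainComplexMap_sub_id R M
    (by rw [← Functor.map_comp, ← TopCat.ofHom_comp, hpT])
    (periodicPts_toSSet_map hT) (toSSet_map_surjective hp hsurj)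
    (exists_iterate_eq_of_toSSet_map_eq hp hpT hfib)

theorem nonempty_singularHomology_one_iso [ContractibleSpace E] {p : C(E, B)} {T : C(E, E)}
    (hp : IsCoveringMap p) (hsurj : Function.Surjective p) (hpT : p.comp T = p)
    (hT : Function.periodicPts T = ∅)
    (hfib : ∀ a b, p a = p b → ∃ k l : ℕ, T^[k] a = T^[l] b) :
    Nonempty (((singularHomologyFunctor (ModuleCat.{u} R) 1).obj (ModuleCat.of R M)).obj
      (TopCat.of B) ≅ ModuleCat.of R M) := by
  have hS := shortExact_singularChains_of_isCoveringMap R M hp hsurj hpT hT hfib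
  have hT_homotopic : T.Homotopic (.id E) := by
    obtain ⟨c, hc⟩ := id_nullhomotopic E
    exact (hc.comp (.refl T)).trans hc.symm
  have hT_homology : HomologicalComplex.homologyMap (SSet.chainComplexMap
      (TopCat.toSSet.map (TopCat.ofHom T)) (ModuleCat.of R M) - 𝟙 _) 0 = 0 := by
    rw [HomologicalComplex.homologyMap_sub, HomologicalComplex.homologyMap_id, sub_eq_zero]
    exact (singularHomology_map_eq_of_homotopic (ModuleCat.of R M) 0 hT_homotopic).trans
      (CategoryTheory.Functor.map_id _ _)
  let δ : ((singularHomologyFunctor (ModuleCat.{u} R) 1).obj (ModuleCat.of R M)).obj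
      (TopCat.of B) ⟶ ((singularHomologyFunctor (ModuleCat.{u} R) 0).obj (ModuleCat.of R M)).obj
      (TopCat.of E) := hS.δ 1 0 rfl
  have hepi : Epi δ := (hS.homology_exact₁ 1 0 rfl).epi_f hT_homology
  have hmono : Mono δ := (hS.homology_exact₃ 1 0 rfl).mono_g
    ((isZero_singularHomology_of_contractibleSpace (ModuleCat.of R M) one_ne_zero).eq_of_src _ _)
  have hδ : IsIso δ := isIso_of_mono_of_epi δ
  have : PathConnectedSpace (TopCat.of E) := inferInstanceAs (PathConnectedSpace E)
  exact ⟨asIso δ ≪≫ asIso (TopCat.singularHomology₀ε (TopCat.of E) (ModuleCat.of R M))⟩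

theorem nonempty_singularHomology_one_circle_iso (M : Type) [AddCommGroup M] [Module R M] :
    Nonempty (((singularHomologyFunctor (ModuleCat.{0} R) 1).obj (ModuleCat.of R M)).obj
      (TopCat.of Circle) ≅ ModuleCat.of R M) := by
  let T : C(ℝ, ℝ) := ⟨(· + 2 * Real.pi), by fun_prop⟩
  have iterate_T (k : ℕ) (x : ℝ) : T^[k] x = x + k * (2 * Real.pi) := by
    rw [← nsmul_eq_mul]
    exact congrFun (add_right_iterate (2 * Real.pi) k) x
  refine nonempty_singularHomology_one_iso R M (p := Circle.exp) (T := T)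
    Circle.isCoveringMap_exp Circle.exp_surjective (ContinuousMap.ext Circle.exp_add_two_pi)
    (Set.eq_empty_of_forall_notMem fun x ⟨k, hk, hx⟩ => ?_) fun a b hab => ?_
  · rw [Function.IsPeriodicPt, Function.IsFixedPt, iterate_T, add_eq_left] at hx
    exact (by positivity : (k : ℝ) * (2 * Real.pi) ≠ 0) hx
  · obtain ⟨m, rfl⟩ := Circle.exp_eq_exp.1 hab
    refine ⟨(-m).toNat, m.toNat, ?_⟩
    have hm : (m.toNat : ℝ) - (-m).toNat = m := mod_cast m.toNat_sub_toNat_neg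
    rw [iterate_T, iterate_T, ← hm]
    ring

end InfiniteCyclicCovering

section QuotientMaps

open Topology

variable {X Y Z : Type*} [TopologicalSpace X] [TopologicalSpace Y] [TopologicalSpace Z]

theorem nonempty_homeomorph_of_isQuotientMap {f : C(X, Y)} {g : C(X, Z)} (hf : IsQuotientMap f)
    (hg : IsQuotientMap g) (hfg : ∀ x y, f x = f y ↔ g x = g y) : Nonempty (Y ≃ₜ Z) := by
  have hker : Setoid.ker f = Setoid.ker g := Setoid.ext hfg
  exact ⟨(hker ▸ hf.homeomorph).symm.trans hg.homeomorph⟩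

theorem nonempty_separationQuotient_homeomorph [T0Space Y] {f : X → Y} (hf : IsInducing f)
    (hsurj : Function.Surjective f) : Nonempty (SeparationQuotient X ≃ₜ Y) :=
  nonempty_homeomorph_of_isQuotientMap
    (f := ⟨SeparationQuotient.mk, SeparationQuotient.continuous_mk⟩) (g := ⟨f, hf.continuous⟩)
    SeparationQuotient.isQuotientMap_mk (hf.isQuotientMap_of_surjective hsurj) fun x y => by
      rw [ContinuousMap.coe_mk, ContinuousMap.coe_mk, SeparationQuotient.mk_eq_mk,
        ← hf.inseparable_iff, inseparable_iff_eq]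

end QuotientMaps

section ContractibleArcs

open Topology

variable {X : Type*} [TopologicalSpace X]

theorem contractibleSpace_of_isEmbedding_real [ConnectedSpace X] {f : X → ℝ}
    (hf : IsEmbedding f) : ContractibleSpace X := by
  have : ContractibleSpace (Set.range f) :=
    (isPreconnected_range hf.continuous).ordConnected.convex.contractibleSpace
      (Set.range_nonempty f)
  exact hf.toHomeomorph.contractibleSpace

theorem coe_circle_mem_slitPlane {z : Circle} (hz : z ≠ Circle.exp Real.pi) :
    (z : ℂ) ∈ Complex.slitPlane := by
  refine Complex.mem_slitPlane_iff_arg.2 ⟨fun harg => hz ?_, z.coe_ne_zero⟩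
  rw [← harg, Circle.exp_arg]

theorem contractibleSpace_of_isConnected_circle {S : Set Circle} (hS : IsConnected S) {c : Circle}
    (hc : c ∉ S) : ContractibleSpace S := by
  have : ConnectedSpace S := isConnected_iff_connectedSpace.1 hS
  -- Multiplication by `u` moves `c` onto the branch cut of `arg`.
  let u : Circle := c⁻¹ * Circle.exp Real.pi
  have rotate_mem_slitPlane (z : S) : ((z * u : Circle) : ℂ) ∈ Complex.slitPlane := by
    refine coe_circle_mem_slitPlane fun h => ne_of_mem_of_not_mem z.2 hc ?_
    rwa [← mul_assoc, mul_eq_right, mul_inv_eq_one] at h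
  let angle : S → ℝ := fun z => Complex.arg (z * u : Circle)
  have hangle : Continuous angle := continuous_iff_continuousAt.2 fun z =>
    (Complex.continuousAt_arg (rotate_mem_slitPlane z)).comp
      (f := fun z : S => ((z * u : Circle) : ℂ)) (by fun_prop)
  have exp_angle : (fun θ : ℝ => Circle.exp θ * u⁻¹) ∘ angle = Subtype.val := funext fun z => by
    rw [Function.comp_apply, Circle.exp_arg, mul_inv_cancel_right]
  exact contractibleSpace_of_isEmbedding_real
    (.of_comp hangle (by fun_prop) (exp_angle ▸ IsEmbedding.subtypeVal))

end ContractibleArcs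

section ProjectiveLine

open Topology

theorem ofConjDivSelf_eq_iff {z w : ℂ} (hz : z ≠ 0) (hw : w ≠ 0) :
    Circle.ofConjDivSelf z hz = Circle.ofConjDivSelf w hw ↔ ∃ a : ℝ, a • w = z := by
  rw [Circle.ext_iff]
  calc starRingEnd ℂ z / z = starRingEnd ℂ w / w ↔ starRingEnd ℂ (z / w) = z / w := by
        rw [map_div₀, div_eq_div_iff hz hw, div_eq_div_iff (by simpa using hw) hw, mul_comm z]
    _ ↔ ∃ a : ℝ, a • w = z := by
        rw [Complex.conj_eq_iff_real]
        exact exists_congr fun a => by rw [div_eq_iff hw, Complex.real_smul, eq_comm]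

/-- The linear isomorphism `(a, b) ↦ a + b i` from `ℝ²` to `ℂ`. -/
noncomputable def planeEquiv : (Fin 2 → ℝ) ≃L[ℝ] ℂ :=
  Complex.basisOneI.equivFun.symm.toContinuousLinearEquiv

/-- The map `z ↦ conj z / z` on nonzero vectors of the plane. It exhibits the circle as the space
of lines through the origin. -/
noncomputable def conjDivSelf : C({v : Fin 2 → ℝ // v ≠ 0}, Circle) where
  toFun v := Circle.ofConjDivSelf (planeEquiv v) (EmbeddingLike.map_ne_zero_iff.2 v.2)
  continuous_toFun := Continuous.subtype_mk
    ((Complex.continuous_conj.comp (by fun_prop)).div (by fun_prop)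
      fun v => EmbeddingLike.map_ne_zero_iff.2 v.2) _

theorem conjDivSelf_eq_iff (v w : {v : Fin 2 → ℝ // v ≠ 0}) :
    conjDivSelf v = conjDivSelf w ↔ Projectivization.mk' ℝ v = Projectivization.mk' ℝ w := by
  rw [Projectivization.mk'_eq_mk, Projectivization.mk'_eq_mk, Projectivization.mk_eq_mk_iff']
  refine Iff.trans (ofConjDivSelf_eq_iff (EmbeddingLike.map_ne_zero_iff.2 v.2)
    (EmbeddingLike.map_ne_zero_iff.2 w.2)) (exists_congr fun a => ?_)
  rw [← map_smul, planeEquiv.injective.eq_iff]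

theorem isQuotientMap_conjDivSelf : IsQuotientMap conjDivSelf := by
  let toPlane : C(Circle, {v : Fin 2 → ℝ // v ≠ 0}) :=
    ⟨fun z => ⟨planeEquiv.symm z, EmbeddingLike.map_ne_zero_iff.2 z.coe_ne_zero⟩, by fun_prop⟩
  have conjDivSelf_toPlane : conjDivSelf ∘ toPlane = (· ^ (-2 : ℤ)) := by
    funext z
    refine Circle.ext ?_
    change starRingEnd ℂ (planeEquiv (planeEquiv.symm z)) / planeEquiv (planeEquiv.symm z) = _
    rw [planeEquiv.apply_symm_apply, ← Circle.coe_inv_eq_conj, ← Circle.coe_div,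
      div_eq_mul_inv, ← sq, ← zpow_natCast, inv_zpow']
    rfl
  refine .of_comp (map_continuous toPlane) (map_continuous conjDivSelf) ?_
  rw [conjDivSelf_toPlane]
  have : NeZero (-2 : ℤ) := ⟨by decide⟩
  exact (Circle.isQuotientCoveringMap_zpow (-2)).toIsQuotientMap

theorem isQuotientMap_projectivization_mk' :
    IsQuotientMap (Y := RP1) (Projectivization.mk' ℝ : {v : Fin 2 → ℝ // v ≠ 0} → _) :=
  ⟨⟨rfl⟩, Quotient.mk''_surjective⟩

theorem nonempty_RP1_homeomorph_circle : Nonempty (RP1 ≃ₜ Circle) :=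
  nonempty_homeomorph_of_isQuotientMap (f := ⟨_, isQuotientMap_projectivization_mk'.continuous⟩)
    isQuotientMap_projectivization_mk' isQuotientMap_conjDivSelf
    fun v w => (conjDivSelf_eq_iff v w).symm

end ProjectiveLine

namespace KuratowskiClosure

open Topology

variable {X : Type}

theorem isClosed_topology_iff (c : KuratowskiClosure X) {A : Set X} :
    IsClosed[c.topology] A ↔ c.cl A = A := by
  rw [← @isOpen_compl_iff]
  change c.cl Aᶜᶜ = Aᶜᶜ ↔ c.cl A = A
  rw [compl_compl]

theorem topology_ofInvolution_eq_induced {Y : Type*} [TopologicalSpace X] [TopologicalSpace Y]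
    {p : X ≃ₜ X} (hp : Function.Involutive p) {f : X → Y} (hf : Continuous f)
    (hf_closed : IsClosedMap f) (hfib : ∀ z w, f z = f w ↔ z = w ∨ z = p w) :
    (ofInvolution p hp).topology = .induced f inferInstance := by
  refine TopologicalSpace.ext_iff_isClosed.2 fun A => ?_
  rw [isClosed_topology_iff, isClosed_induced_iff]
  constructor
  · intro (hA : closure A ∪ p '' closure A = A)
    have hA_closed : IsClosed A := isClosed_of_closure_subset (Set.subset_union_left.trans hA.le)
    have hpA : p '' A ⊆ A :=
      (Set.image_mono subset_closure).trans (Set.subset_union_right.trans hA.le)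
    refine ⟨f '' A, hf_closed A hA_closed, Set.Subset.antisymm ?_ (Set.subset_preimage_image f A)⟩
    rintro z ⟨w, hw, hwz⟩
    rcases (hfib z w).1 hwz.symm with rfl | rfl
    exacts [hw, hpA ⟨w, hw, rfl⟩]
  · rintro ⟨B, hB, rfl⟩
    change closure (f ⁻¹' B) ∪ p '' closure (f ⁻¹' B) = f ⁻¹' B
    rw [(hB.preimage hf).closure_eq, Set.union_eq_left, Set.image_subset_iff]
    intro w hw
    rwa [Set.mem_preimage, Set.mem_preimage, (hfib (p w) w).2 (.inr rfl)]

end KuratowskiClosure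

section Arcs

open Set
open scoped FourierTransform

theorem toCircle_coe (t : ℝ) : AddCircle.toCircle (t : UnitAddCircle) = 𝐞 t := by
  rw [AddCircle.toCircle_apply_mk, div_one, Real.fourierChar_apply']

theorem eq_of_fourierChar_eq {s t : ℝ} (h : 𝐞 s = 𝐞 t) (hst : |s - t| < 1) : s = t := by
  obtain ⟨m, hm⟩ := Circle.exp_eq_exp.1 h
  have hsub : s - t = m := by
    refine mul_left_cancel₀ Real.two_pi_pos.ne' ?_
    linear_combination hm
  have hm_zero : m = 0 := Int.abs_lt_one_iff.1 (by rw [hsub] at hst; exact_mod_cast hst)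
  rw [← sub_eq_zero, hsub, hm_zero, Int.cast_zero]

theorem fourierChar_image_Ico (a : ℝ) : 𝐞 '' Ico a (a + 1) = univ := by
  have : Fact ((0 : ℝ) < 1) := ⟨one_pos⟩
  have hcomp : ⇑𝐞 = AddCircle.toCircle ∘ ((↑) : ℝ → UnitAddCircle) :=
    funext fun t => (toCircle_coe t).symm
  rw [hcomp, image_comp, AddCircle.coe_image_Ico_eq, image_univ]
  exact range_eq_univ.2 fun z =>
    ⟨(AddCircle.homeomorphCircle one_ne_zero).symm z, by
      rw [← AddCircle.homeomorphCircle_apply one_ne_zero, Homeomorph.apply_symm_apply]⟩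

theorem fourierChar_image_inter {I J : Set ℝ} (hIJ : ∀ s ∈ I, ∀ t ∈ J, |s - t| < 1) :
    𝐞 '' I ∩ 𝐞 '' J = 𝐞 '' (I ∩ J) := by
  refine Subset.antisymm ?_ (image_inter_subset _ _ _)
  rintro _ ⟨⟨s, hs, rfl⟩, t, ht, hts⟩
  obtain rfl := eq_of_fourierChar_eq hts.symm (hIJ s hs t ht)
  exact ⟨s, ⟨hs, ht⟩, rfl⟩

theorem K_eq_fourierChar_image : K = 𝐞 '' Ico 0 (1 / 2) :=
  rfl

theorem D_eq_fourierChar_image : D = 𝐞 '' Ico (1 / 2) 1 := by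
  have hunion : K ∪ 𝐞 '' Ico (1 / 2) 1 = univ := by
    rw [K_eq_fourierChar_image, ← image_union, Ico_union_Ico_eq_Ico (by norm_num) (by norm_num),
      ← fourierChar_image_Ico 0, zero_add]
  have hinter : K ∩ 𝐞 '' Ico (1 / 2) 1 = ∅ := by
    rw [K_eq_fourierChar_image, fourierChar_image_inter, Ico_disjoint_Ico_same.inter_eq,
      image_empty]
    rintro s ⟨_, _⟩ t ⟨_, _⟩
    rw [abs_lt]
    constructor <;> linarith
  exact (IsCompl.of_eq hinter hunion).compl_eq

theorem circleAct_affine_image (t : ℝ) (v : ℤˣ) (I : Set ℝ) :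
    circleAct (affine t v) '' (𝐞 '' I) = 𝐞 '' ((fun s => (v : ℤ) * s + t) '' I) := by
  simp_rw [image_image]
  refine image_congr fun s _ => ?_
  change 𝐞 s ^ (v : ℤ) * AddCircle.toCircle (t : UnitAddCircle) = _
  rw [toCircle_coe, AddChar.map_add_eq_mul, ← zsmul_eq_mul, AddChar.map_zsmul_eq_zpow]

theorem circleAct_affine_one_image_K (t : ℝ) :
    circleAct (affine t 1) '' K = 𝐞 '' Ico t (t + 1 / 2) := by
  rw [K_eq_fourierChar_image, circleAct_affine_image]
  simp [add_comm]

theorem circleAct_affine_neg_one_image_K (t : ℝ) :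
    circleAct (affine t (-1)) '' K = 𝐞 '' Ioc (t - 1 / 2) t := by
  rw [K_eq_fourierChar_image, circleAct_affine_image]
  simp [neg_add_eq_sub]

theorem circleAct_affine_one_image_K_inter_K {t : ℝ} (ht : t ∈ Ico (-1 / 2) (1 / 2)) :
    circleAct (affine t 1) '' K ∩ K = 𝐞 '' (Ico t (t + 1 / 2) ∩ Ico 0 (1 / 2)) := by
  rw [circleAct_affine_one_image_K, K_eq_fourierChar_image, fourierChar_image_inter]
  grind

theorem circleAct_affine_neg_one_image_K_inter_K {t : ℝ} (ht : t ∈ Ico 0 1) :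
    circleAct (affine t (-1)) '' K ∩ K = 𝐞 '' (Ioc (t - 1 / 2) t ∩ Ico 0 (1 / 2)) := by
  rw [circleAct_affine_neg_one_image_K, K_eq_fourierChar_image, fourierChar_image_inter]
  grind

theorem exists_affine_eq (a : ℝ) (g : G) : ∃ t ∈ Ico a (a + 1), affine t g.right = g := by
  have : Fact ((0 : ℝ) < 1) := ⟨one_pos⟩
  obtain ⟨t, ht, hg⟩ := (AddCircle.coe_image_Ico_eq 1 a).ge (mem_univ (Multiplicative.toAdd g.left))
  exact ⟨t, ht, SemidirectProduct.ext hg rfl⟩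

theorem exists_affine_one_or_affine_neg_one (g : G) :
    (∃ t ∈ Ico (-1 / 2 : ℝ) (1 / 2), affine t 1 = g) ∨ ∃ t ∈ Ico (0 : ℝ) 1, affine t (-1) = g := by
  rcases Int.units_eq_one_or g.right with hg | hg
  · obtain ⟨t, ht, h⟩ := exists_affine_eq (-1 / 2) g
    exact .inl ⟨t, by grind, by rw [← h, hg]⟩
  · obtain ⟨t, ht, h⟩ := exists_affine_eq 0 g
    exact .inr ⟨t, by grind, by rw [← h, hg]⟩

theorem isPreconnected_circleAct_image_K_inter_K (g : G) :
    IsPreconnected (circleAct g '' K ∩ K) := by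
  have hcont : Continuous 𝐞 := Real.continuous_fourierChar
  rcases exists_affine_one_or_affine_neg_one g with ⟨t, ht, rfl⟩ | ⟨t, ht, rfl⟩
  · rw [circleAct_affine_one_image_K_inter_K ht]
    exact (ordConnected_Ico.inter ordConnected_Ico).isPreconnected.image _ hcont.continuousOn
  · rw [circleAct_affine_neg_one_image_K_inter_K ht]
    exact (ordConnected_Ioc.inter ordConnected_Ico).isPreconnected.image _ hcont.continuousOn

theorem affine_neg_half_one : affine (-1 / 2) 1 = quasipolarity := by
  rw [affine, quasipolarity, affine, ← AddCircle.coe_add_period 1 (-1 / 2)]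
  norm_num

theorem circleAct_image_K_inter_K_nonempty {g : G} (hg : g ≠ quasipolarity) :
    (circleAct g '' K ∩ K).Nonempty := by
  rcases exists_affine_one_or_affine_neg_one g with ⟨t, ht, rfl⟩ | ⟨t, ht, rfl⟩
  · have ht_ne : t ≠ -1 / 2 := by
      rintro rfl
      exact hg affine_neg_half_one
    rw [circleAct_affine_one_image_K_inter_K ht, image_nonempty]
    exact ⟨max t 0, by grind⟩
  · rw [circleAct_affine_neg_one_image_K_inter_K ht, image_nonempty]
    exact ⟨t / 2, by grind⟩

theorem circleAct_quasipolarity_image_K : circleAct quasipolarity '' K = D := by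
  rw [quasipolarity, circleAct_affine_one_image_K, D_eq_fourierChar_image, add_halves]

theorem exists_circleAct_image_K_separating {y k : Circle} (hy : y ∈ K) (hk : k ∈ K)
    (hyk : y ≠ k) : ∃ g, y ∈ circleAct g '' K ∧ k ∉ circleAct g '' K := by
  obtain ⟨s, hs, rfl⟩ := K_eq_fourierChar_image ▸ hy
  obtain ⟨r, hr, rfl⟩ := K_eq_fourierChar_image ▸ hk
  have separates {t : ℝ} (ht : t ∈ Ico (-1 / 2) (1 / 2)) (hst : s ∈ Ico t (t + 1 / 2))
      (hrt : r ∉ Ico t (t + 1 / 2)) :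
      𝐞 s ∈ circleAct (affine t 1) '' K ∧ 𝐞 r ∉ circleAct (affine t 1) '' K := by
    rw [circleAct_affine_one_image_K]
    refine ⟨mem_image_of_mem _ hst, ?_⟩
    rintro ⟨u, hu, hur⟩
    exact hrt (eq_of_fourierChar_eq hur (by grind) ▸ hu)
  rcases lt_or_gt_of_ne (ne_of_apply_ne 𝐞 hyk) with hsr | hrs
  · exact ⟨_, separates (t := r - 1 / 2) (by grind) (by grind) (by grind)⟩
  · exact ⟨_, separates (t := s) (by grind) (by grind) (by grind)⟩

theorem K_nontrivial : K.Nontrivial := by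
  rw [K_eq_fourierChar_image]
  refine Nontrivial.image_of_injOn ?_ fun s hs t ht h => eq_of_fourierChar_eq h (by grind)
  exact nontrivial_of_mem_mem_ne (x := 0) (y := 1 / 4) (by norm_num) (by norm_num) (by norm_num)

theorem injOn_sq_K : InjOn (fun y : Circle => y ^ 2) K := by
  rintro _ ⟨s, hs, rfl⟩ _ ⟨t, ht, rfl⟩ h
  have h_double : 𝐞 (2 * s) = 𝐞 (2 * t) := by
    rwa [two_mul, two_mul, AddChar.map_add_eq_mul, AddChar.map_add_eq_mul, ← sq, ← sq]
  have := eq_of_fourierChar_eq h_double (by grind)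
  rw [show s = t by linarith]

end Arcs

section Action

open scoped FourierTransform

theorem circleAct_quasipolarity (y : Circle) : circleAct quasipolarity y = y * 𝐞 (1 / 2) := by
  rw [← toCircle_coe]
  exact congrArg (· * _) (zpow_one y)

theorem torusAct_quasipolarity_apply (z : Torus) :
    torusAct quasipolarity z = (z.1, z.2 * 𝐞 (1 / 2)) :=
  Prod.ext (zpow_one z.1) (circleAct_quasipolarity z.2)

theorem fourierChar_half : (𝐞 (1 / 2) : ℂ) = -1 := by
  rw [Real.fourierChar_apply', mul_one_div, mul_div_cancel_left₀ _ two_ne_zero, Circle.coe_exp,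
    Complex.exp_pi_mul_I]

theorem bijective_circleAct (g : G) : Function.Bijective (circleAct g) := by
  refine ⟨fun x y h => ?_, fun y => ?_⟩
  · have hxy : torusAct g (1, x) = torusAct g (1, y) := Prod.ext rfl h
    exact congrArg Prod.snd ((torusAct g).injective hxy)
  · obtain ⟨z, hz⟩ := (torusAct g).surjective (1, y)
    exact ⟨z.2, congrArg Prod.snd hz⟩

theorem involutive_lin (v : ℤˣ) : Function.Involutive (lin v) := fun x => by
  rw [lin, lin, ← zpow_mul, ← Units.val_mul, Int.units_mul_self, Units.val_one, zpow_one]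

theorem torusAct_image_univ_prod (g : G) (A : Set Circle) :
    torusAct g '' (Set.univ ×ˢ A) = Set.univ ×ˢ (circleAct g '' A) := by
  change Prod.map (lin g.right) (circleAct g) '' (Set.univ ×ˢ A) = _
  rw [Set.prodMap_image_prod, Set.image_univ, (involutive_lin _).surjective.range_eq]

theorem successorSet_eq (g : G) : successorSet g = Set.univ ×ˢ (circleAct g '' K ∩ K) := by
  rw [successorSet, Keps, torusAct_image_univ_prod, Set.prod_inter_prod, Set.univ_inter]

theorem commute_torusAct_quasipolarity (g : G) :
    Commute (torusAct g) (torusAct quasipolarity) := by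
  have hlin : lin g.right (𝐞 (1 / 2)) = 𝐞 (1 / 2) := by
    have hsq : 𝐞 (1 / 2) * 𝐞 (1 / 2) = 1 := by
      rw [Circle.ext_iff, Circle.coe_mul, fourierChar_half, neg_mul_neg, one_mul, Circle.coe_one]
    rcases Int.units_eq_one_or g.right with h | h <;> rw [h]
    · exact zpow_one _
    · exact (zpow_neg_one _).trans (inv_eq_of_mul_eq_one_left hsq)
  ext1 z
  change torusAct g (torusAct quasipolarity z) = torusAct quasipolarity (torusAct g z)
  rw [torusAct_quasipolarity_apply, torusAct_quasipolarity_apply]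
  refine Prod.ext rfl ?_
  change lin g.right (z.2 * 𝐞 (1 / 2)) * _ = lin g.right z.2 * _ * _
  rw [lin, mul_zpow, mul_right_comm, ← lin, ← lin, hlin]

theorem admissible_iff (ξ : Torus) (g : G) : Admissible ξ g ↔ ξ.2 ∉ circleAct g '' K := by
  have hmem : ξ ∈ torusAct g '' Deps ↔ ξ.2 ∉ circleAct g '' K := by
    rw [Deps, torusAct_image_univ_prod, D, Set.image_compl_eq (bijective_circleAct g)]
    exact and_iff_right (Set.mem_univ _)
  exact ⟨fun h => hmem.1 h.mem, fun h => ⟨hmem.2 h, commute_torusAct_quasipolarity g⟩⟩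

theorem successorSet_eq_empty_iff (g : G) : successorSet g = ∅ ↔ g = quasipolarity := by
  rw [successorSet_eq]
  refine ⟨fun h => of_not_not fun hg => ?_, ?_⟩
  · exact (Set.univ_nonempty.prod (circleAct_image_K_inter_K_nonempty hg)).ne_empty h
  · rintro rfl
    rw [circleAct_quasipolarity_image_K, D, Set.compl_inter_self, Set.prod_empty]

theorem torusAct_image_Keps_eq_Deps_iff (g : G) :
    torusAct g '' Keps = Deps ↔ g = quasipolarity := by
  refine ⟨fun h => (successorSet_eq_empty_iff g).1 ?_, ?_⟩
  · rw [successorSet, h, Deps, Keps, Set.prod_inter_prod, D, Set.compl_inter_self, Set.prod_empty]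
  · rintro rfl
    rw [Keps, torusAct_image_univ_prod, circleAct_quasipolarity_image_K, Deps]

end Action

section Topologies

open Topology

theorem prodMap_sq_eq_iff (z w : Torus) : Prod.map id (· ^ 2) z = Prod.map id (· ^ 2) w ↔
    z = w ∨ z = torusAct quasipolarity w := by
  rw [torusAct_quasipolarity_apply, Prod.map, Prod.map, Prod.mk.injEq, Prod.ext_iff, Prod.ext_iff,
    ← and_or_left]
  refine and_congr_right fun _ => ?_
  simp only [Circle.ext_iff, Circle.coe_pow, Circle.coe_mul, fourierChar_half, mul_neg_one]
  exact sq_eq_sq_iff_eq_or_eq_neg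

theorem sq_circle_surjective : Function.Surjective fun y : Circle => y ^ 2 :=
  (Circle.isQuotientCoveringMap_npow 2).surjective

theorem kuratowskiTopology_eq_induced :
    kuratowskiTopology = standardTopology.induced (Prod.map id (· ^ 2)) :=
  have hcont : Continuous (Prod.map id (· ^ 2) : Torus → Torus) := by fun_prop
  KuratowskiClosure.topology_ofInvolution_eq_induced _ hcont hcont.isClosedMap prodMap_sq_eq_iff

theorem isInducing_subspaceOf {τ : TopologicalSpace Torus} {p : Circle → Circle}
    (hτ : τ = standardTopology.induced (Prod.map id p)) (A : Set Torus) :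
    @IsInducing _ _ _ standardTopology fun z : SubspaceOf τ A => Prod.map id p z.1.point := by
  subst hτ
  exact IsInducing.comp (g := fun z : TorusWith _ => Prod.map id p z.point) ⟨rfl⟩ .subtypeVal

theorem nonempty_separationQuotient_torus :
    Nonempty (SeparationQuotient (TorusWith kuratowskiTopology) ≃ₜ Torus) :=
  nonempty_separationQuotient_homeomorph
    (f := fun z : TorusWith kuratowskiTopology => Prod.map id (· ^ 2) z.point)
    ⟨kuratowskiTopology_eq_induced⟩ (Function.surjective_id.prodMap sq_circle_surjective)

theorem nonempty_separationQuotient_fibre (x : Circle) :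
    Nonempty (SeparationQuotient (SubspaceOf kuratowskiTopology (fibre x)) ≃ₜ RP1) := by
  let f : SubspaceOf kuratowskiTopology (fibre x) → Circle := fun z => z.1.point.2 ^ 2
  have hcomp : Prod.mk x ∘ f = fun z => Prod.map id (· ^ 2) z.1.point :=
    funext fun z => Prod.ext z.2.1.symm rfl
  have hf : IsInducing f := (isEmbedding_prodMkRight x).isInducing.of_comp_iff.1 <| by
    rw [hcomp]
    exact isInducing_subspaceOf kuratowskiTopology_eq_induced (fibre x)
  have hsurj : Function.Surjective f := fun y => by
    obtain ⟨w, hw⟩ := sq_circle_surjective y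
    exact ⟨⟨(x, w), rfl, trivial⟩, hw⟩
  obtain ⟨e⟩ := nonempty_separationQuotient_homeomorph hf hsurj
  obtain ⟨e'⟩ := nonempty_RP1_homeomorph_circle
  exact ⟨e.trans e'.symm⟩

theorem nonempty_subspaceOf_homeomorph {τ : TopologicalSpace Torus} {p : Circle → Circle}
    (hτ : τ = standardTopology.induced (Prod.map id p)) {J : Set Circle} (hJ : Set.InjOn p J) :
    Nonempty (SubspaceOf τ (Set.univ ×ˢ J) ≃ₜ Circle × (p '' J)) := by
  subst hτ
  let f : SubspaceOf (standardTopology.induced (Prod.map id p)) (Set.univ ×ˢ J) →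
      Circle × (p '' J) := fun z => (z.1.point.1, ⟨p z.1.point.2, z.1.point.2, z.2.2, rfl⟩)
  have hf : IsInducing f :=
    (IsInducing.id.prodMap (IsInducing.subtypeVal (t := p '' J))).of_comp_iff.1
      (isInducing_subspaceOf rfl _)
  have hbij : Function.Bijective f := by
    refine ⟨fun z w h => ?_, ?_⟩
    · obtain ⟨hfst, hsnd⟩ := Prod.ext_iff.1 h
      exact Subtype.ext (Prod.ext hfst (hJ z.2.2 w.2.2 (congrArg Subtype.val hsnd)))
    · rintro ⟨x, _, y, hy, rfl⟩
      exact ⟨⟨(x, y), trivial, hy⟩, rfl⟩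
  exact ⟨(Equiv.ofBijective f hbij).toHomeomorphOfIsInducing hf⟩

/-- The topologies on the torus that see the discantus interval through a continuous map
injective on the consonances. Both topologies of the theorem are of this kind, by the identity
and by squaring. -/
def InducedByDiscantus (τ : TopologicalSpace Torus) : Prop :=
  ∃ p : Circle → Circle, Continuous p ∧ Set.InjOn p K ∧
    τ = standardTopology.induced (Prod.map id p)

theorem inducedByDiscantus_of_eq {τ : TopologicalSpace Torus}
    (hτ : τ = standardTopology ∨ τ = kuratowskiTopology) : InducedByDiscantus τ := by
  rcases hτ with rfl | rfl
  · exact ⟨id, continuous_id, Set.injOn_id K, by rw [Prod.map_id, induced_id]⟩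
  · exact ⟨(· ^ 2), continuous_pow 2, injOn_sq_K, kuratowskiTopology_eq_induced⟩

end Topologies

section HomologicalSymmetries

variable {τ : TopologicalSpace Torus} {ξ : Torus} {g : G}

theorem nonempty_homotopyEquiv_circle (hτ : InducedByDiscantus τ) (hξ : ξ ∈ Keps)
    (hg : Admissible ξ g) (hgq : g ≠ quasipolarity) :
    Nonempty (SubspaceOf τ (successorSet g) ≃ₕ Circle) := by
  obtain ⟨p, hp, hpK, hτp⟩ := hτ
  have hconn : IsConnected (p '' (circleAct g '' K ∩ K)) :=
    IsConnected.image ⟨circleAct_image_K_inter_K_nonempty hgq,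
      isPreconnected_circleAct_image_K_inter_K g⟩ p hp.continuousOn
  have hmiss : p ξ.2 ∉ p '' (circleAct g '' K ∩ K) := by
    rintro ⟨y, hy, hyξ⟩
    exact (admissible_iff ξ g).1 hg (hpK hy.2 hξ.2 hyξ ▸ hy.1)
  have := contractibleSpace_of_isConnected_circle hconn hmiss
  obtain ⟨arc⟩ := ContractibleSpace.hequiv_unit (p '' (circleAct g '' K ∩ K))
  obtain ⟨product⟩ := nonempty_subspaceOf_homeomorph hτp (hpK.mono Set.inter_subset_right)
  rw [successorSet_eq]
  let shrink := (ContinuousMap.HomotopyEquiv.refl Circle).prodCongr arc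
  exact ⟨(product.toHomotopyEquiv.trans shrink).trans
    (Homeomorph.prodPUnit Circle).toHomotopyEquiv⟩

theorem nonempty_H1_iso_int {Y : Type} [TopologicalSpace Y] (e : Y ≃ₕ Circle) :
    Nonempty (H1 Y ≅ ModuleCat.of ℤ ℤ) :=
  (nonempty_singularHomology_one_circle_iso ℤ ℤ).map (singularHomologyIso _ 1 e ≪≫ ·)

theorem rank_H1_of_homotopyEquiv_circle {Y : Type} [TopologicalSpace Y] (e : Y ≃ₕ Circle) :
    Module.rank ℤ (H1 Y) = 1 := by
  obtain ⟨i⟩ := nonempty_H1_iso_int e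
  exact i.toLinearEquiv.rank_eq.trans (Module.rank_self ℤ)

theorem rank_H1_of_isEmpty (Y : Type) [TopologicalSpace Y] [IsEmpty Y] :
    Module.rank ℤ (H1 Y) = 0 := by
  have hzero : CategoryTheory.Limits.IsZero (H1 Y) :=
    AlgebraicTopology.isZero_singularHomologyFunctor_of_totallyDisconnectedSpace
      (ModuleCat.{0} ℤ) 1 (ModuleCat.of ℤ ℤ) (TopCat.of Y) one_ne_zero
  have := ModuleCat.subsingleton_of_isZero hzero
  exact rank_subsingleton' ℤ (H1 Y)

theorem rank_H1_successorSet_quasipolarity (τ : TopologicalSpace Torus) :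
    Module.rank ℤ (H1 (SubspaceOf τ (successorSet quasipolarity))) = 0 := by
  rw [(successorSet_eq_empty_iff quasipolarity).2 rfl]
  have : IsEmpty (SubspaceOf τ ∅) := ⟨fun z => z.2⟩
  exact rank_H1_of_isEmpty _

theorem rank_H1_successorSet (hτ : InducedByDiscantus τ) (hξ : ξ ∈ Keps) (hg : Admissible ξ g)
    (hgq : g ≠ quasipolarity) : Module.rank ℤ (H1 (SubspaceOf τ (successorSet g))) = 1 :=
  (nonempty_homotopyEquiv_circle hτ hξ hg hgq).elim rank_H1_of_homotopyEquiv_circle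

theorem exists_admissible_mem_successorSet {z : Torus} (hξ : ξ ∈ Keps) (hz : z ∈ Keps)
    (hzξ : z.2 ≠ ξ.2) : ∃ g, Admissible ξ g ∧ g ≠ quasipolarity ∧ z ∈ successorSet g := by
  obtain ⟨g, hzg, hξg⟩ := exists_circleAct_image_K_separating hz.2 hξ.2 hzξ
  have hmem : z ∈ successorSet g := by
    rw [successorSet_eq]
    exact ⟨trivial, hzg, hz.2⟩
  refine ⟨g, (admissible_iff ξ g).2 hξg, ?_, hmem⟩
  rw [ne_eq, ← successorSet_eq_empty_iff]
  exact Set.Nonempty.ne_empty ⟨z, hmem⟩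

theorem isHomologicalSymmetry_iff (hτ : InducedByDiscantus τ) (hξ : ξ ∈ Keps) (g : G) :
    IsHomologicalSymmetry τ ξ g ↔ Admissible ξ g ∧ g ≠ quasipolarity := by
  refine ⟨fun h => ⟨h.admissible, ?_⟩, fun ⟨hg, hgq⟩ => ⟨hg, fun h hh => ?_⟩⟩
  · rintro rfl
    obtain ⟨y, hy, hyξ⟩ := K_nontrivial.exists_ne ξ.2
    obtain ⟨g, hg, hgq, -⟩ :=
      exists_admissible_mem_successorSet (z := (1, y)) hξ ⟨trivial, hy⟩ hyξ
    have hle := h.maximal g hg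
    rw [rank_H1_successorSet_quasipolarity, rank_H1_successorSet hτ hξ hg hgq] at hle
    exact hle.not_gt zero_lt_one
  · rw [rank_H1_successorSet hτ hξ hg hgq]
    by_cases hhq : h = quasipolarity
    · rw [hhq, rank_H1_successorSet_quasipolarity]
      exact zero_le_one
    · exact (rank_H1_successorSet hτ hξ hh hhq).le

theorem admittedSuccessors_eq (hτ : InducedByDiscantus τ) (hξ : ξ ∈ Keps) :
    admittedSuccessors τ ξ = {z ∈ Keps | z.2 ≠ ξ.2} := by
  ext z
  constructor
  · rintro ⟨g, hg, hz⟩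
    refine ⟨hz.2, fun hzξ => (admissible_iff ξ g).1 hg.admissible (hzξ ▸ ?_)⟩
    rw [successorSet_eq] at hz
    exact hz.2.1
  · rintro ⟨hz, hzξ⟩
    obtain ⟨g, hg, hgq, hzg⟩ := exists_admissible_mem_successorSet hξ hz hzξ
    exact ⟨g, (isHomologicalSymmetry_iff hτ hξ g).2 ⟨hg, hgq⟩, hzg⟩

end HomologicalSymmetries

end ContinuousCounterpoint

open ContinuousCounterpoint in
theorem mainTheorem5 :
    -- `T` with the closure operator induced by `e^{1/2} 1` is, after identification of
    -- topologically indistinguishable points, homeomorphic to `T`; so is each section to `ℝP¹ ≅ S¹`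
    Nonempty (SeparationQuotient (TorusWith kuratowskiTopology) ≃ₜ Torus) ∧
    (∀ x : Circle,
      Nonempty (SeparationQuotient (SubspaceOf kuratowskiTopology (fibre x)) ≃ₜ RP1)) ∧
    Nonempty (RP1 ≃ₜ Circle) ∧
    -- `e^{1/2} 1` is the self-complementary map, and the only one with empty intersection
    (∀ g : G, torusAct g '' Keps = Deps ↔ g = quasipolarity) ∧
    (∀ g : G, successorSet g = ∅ ↔ g = quasipolarity) ∧
    -- for both topologies and every consonant interval
    (∀ τ : TopologicalSpace Torus, τ = standardTopology ∨ τ = kuratowskiTopology →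
      ∀ ξ ∈ Keps,
        (∀ g : G, Admissible ξ g → g ≠ quasipolarity →
          Nonempty (SubspaceOf τ (successorSet g) ≃ₕ Circle) ∧
          Nonempty (H1 (SubspaceOf τ (successorSet g)) ≅ ModuleCat.of ℤ ℤ)) ∧
        (∀ g : G, IsHomologicalSymmetry τ ξ g ↔ Admissible ξ g ∧ g ≠ quasipolarity) ∧
        admittedSuccessors τ ξ = {z ∈ Keps | z.2 ≠ ξ.2}) := by
  exact ⟨nonempty_separationQuotient_torus, nonempty_separationQuotient_fibre,
    nonempty_RP1_homeomorph_circle, torusAct_image_Keps_eq_Deps_iff, successorSet_eq_empty_iff,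
    fun τ hτ ξ hξ =>
      have hτ' := inducedByDiscantus_of_eq hτ
      ⟨fun g hg hgq =>
        have h := nonempty_homotopyEquiv_circle hτ' hξ hg hgq
        ⟨h, h.elim nonempty_H1_iso_int⟩,
      isHomologicalSymmetry_iff hτ' hξ, admittedSuccessors_eq hτ' hξ⟩⟩
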